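/- Let $p,q,r\in\{1,2,3,\dots\}\cup\{\infty\}$ with $p^{-1}+q^{-1}+r^{-1}<1$ (where $\infty^{-1}=0$), and suppose that at least one of $p,q,r$ is $\infty$. Let $$\Gamma=\Delta(p,q,r)=\langle X,Y,Z\mid X^p=Y^q=Z^r=XYZ=1\rangle ,$$ where any relation $W^{\infty}=1$ is omitted. Let $\mathfrak C$ be the category of oriented hypermaps of type $(p,q,r)$: its objects are sets $\Omega$ with permutations $x,y,z$ satisfying $x^p=y^q=z^r=xyz=1$ (again omitting any relation with exponent $\infty$), that is, permutation representations $\Gamma\to\mathrm{Sym}(\Omega)$; its morphisms are the functions $\Omega_1\to\Omega_2$ commuting with $x,y,z$; and an object is connected if $\Omega$ is non-empty and $\Gamma$ acts transitively on it. Then $\Gamma$ and $\mathfrak C$ have the countable automorphism realisation property, that is, for every countable (finite or infinite) group $A$: 1. there is a subgroup $M$ of $\Gamma$ such that $N_\Gamma(M)/M\cong A$; 2. there is a connected object $\mathcal O$ of $\mathfrak C$ such that $\mathrm{Aut}_{\mathfrak C}(\mathcal O)\cong A$. -/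

import Mathlib

open scoped ENNReal

open CategoryTheory

universe u v w

/-- The defining relators of `Δ(p,q,r)` in the free group on `X = of 0`, `Y = of 1`, `Z = of 2`,
namely `X^p`, `Y^q`, `Z^r` and `XYZ`, where a relator with exponent `∞` is omitted. -/
def triangleRelators (p q r : ℕ∞) : Set (FreeGroup (Fin 3)) :=
  {w | (∃ n : ℕ, p = n ∧ w = FreeGroup.of 0 ^ n) ∨
    (∃ n : ℕ, q = n ∧ w = FreeGroup.of 1 ^ n) ∨
    (∃ n : ℕ, r = n ∧ w = FreeGroup.of 2 ^ n) ∨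
    w = FreeGroup.of 0 * FreeGroup.of 1 * FreeGroup.of 2}

/-- The triangle group `Δ(p,q,r) = ⟨X, Y, Z ∣ X^p = Y^q = Z^r = XYZ = 1⟩`. -/
abbrev TriangleGroup (p q r : ℕ∞) : Type := PresentedGroup (triangleRelators p q r)

/-- The triple `(p,q,r)` is hyperbolic: `1/p + 1/q + 1/r < 1`. In `ℝ≥0∞` one has `1/∞ = 0`;
also `1/0 = ∞`, so that a hyperbolic triple has no zero entry. -/
def IsHyperbolicTriple (p q r : ℕ∞) : Prop :=
  (p : ℝ≥0∞)⁻¹ + (q : ℝ≥0∞)⁻¹ + (r : ℝ≥0∞)⁻¹ < 1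

/-- The countable automorphism realisation property of a group `G`: every countable group `A`
is isomorphic to `N_G(M) / M` for some subgroup `M` of `G`. -/
def GroupHasCARP (G : Type u) [Group G] : Prop :=
  ∀ (A : Type v) [Group A] [Countable A], ∃ M : Subgroup G,
    Nonempty (A ≃* Subgroup.normalizer (M : Set G) ⧸ M.subgroupOf (Subgroup.normalizer (M : Set G)))

/-- The countable automorphism realisation property of a category in which certain objects are
singled out as the connected ones: every countable group `A` is isomorphic to the automorphism
group of some connected object. -/
def CategoryHasCARP (C : Type u) [Category.{w} C] (Connected : C → Prop) : Prop :=
  ∀ (A : Type v) [Group A] [Countable A], ∃ O : C, Connected O ∧ Nonempty (A ≃* Aut O)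

/-- An oriented hypermap of type `(p,q,r)`: a set `Ω` (the edges of its bipartite map) with
permutations `x`, `y`, `z` (the rotations of edges around black vertices, white vertices and
faces) such that `xyz = 1` and `x^p = y^q = z^r = 1`, a condition with exponent `∞` being void.
This is the same as a permutation representation of `Δ(p,q,r)` on `Ω`. -/
structure OrientedHypermap (p q r : ℕ∞) : Type (w + 1) where
  /-- The underlying set. -/
  Ω : Type w
  x : Equiv.Perm Ω
  y : Equiv.Perm Ω
  z : Equiv.Perm Ω
  x_pow : ∀ n : ℕ, p = n → x ^ n = 1
  y_pow : ∀ n : ℕ, q = n → y ^ n = 1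
  z_pow : ∀ n : ℕ, r = n → z ^ n = 1
  xyz : x * y * z = 1

namespace OrientedHypermap

variable {p q r : ℕ∞}

/-- A morphism of oriented hypermaps: a function commuting with `x`, `y` and `z`. -/
@[ext]
structure Hom (O₁ O₂ : OrientedHypermap.{w} p q r) : Type w where
  toFun : O₁.Ω → O₂.Ω
  map_x : ∀ a, toFun (O₁.x a) = O₂.x (toFun a)
  map_y : ∀ a, toFun (O₁.y a) = O₂.y (toFun a)
  map_z : ∀ a, toFun (O₁.z a) = O₂.z (toFun a)

/-- The category of oriented hypermaps of type `(p,q,r)`. -/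
instance : Category (OrientedHypermap.{w} p q r) where
  Hom := Hom
  id O := ⟨id, fun _ => rfl, fun _ => rfl, fun _ => rfl⟩
  comp f g := ⟨g.toFun ∘ f.toFun,
    fun a => by simp [f.map_x, g.map_x],
    fun a => by simp [f.map_y, g.map_y],
    fun a => by simp [f.map_z, g.map_z]⟩

/-- The monodromy representation `Δ(p,q,r) → Sym(Ω)`, `X ↦ x`, `Y ↦ y`, `Z ↦ z`. -/
def monodromy (O : OrientedHypermap.{w} p q r) : TriangleGroup p q r →* Equiv.Perm O.Ω :=
  PresentedGroup.toGroup (f := ![O.x, O.y, O.z]) (by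
    rintro _ (⟨n, h, rfl⟩ | ⟨n, h, rfl⟩ | ⟨n, h, rfl⟩ | rfl)
    · simpa using O.x_pow n h
    · simpa using O.y_pow n h
    · simpa using O.z_pow n h
    · simpa using O.xyz)

/-- An oriented hypermap is connected if `Δ(p,q,r)` is transitive on its (non-empty) underlying
set. -/
def IsConnected (O : OrientedHypermap.{w} p q r) : Prop :=
  Nonempty O.Ω ∧ ∀ a b : O.Ω, ∃ g : TriangleGroup p q r, O.monodromy g a = b

end OrientedHypermap

/-!
For a transitive action of a group `Γ` on `Ω` and `M` the stabiliser of a point `o`, both `N_Γ(M)/M`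
and the group of `Γ`-equivariant permutations of `Ω` are determined by the points with the same
stabiliser as `o`. If a group `A` acts on `Ω`, commuting with `Γ`, freely at `o`, and if its orbit
contains every point fixed by `M`, then both groups are isomorphic to `A`
(`IsRigidAction.exists_normalizer_quotient`, `OrientedHypermap.nonempty_mulEquiv_aut`).

If one of `p, q, r` is `∞`, then `Γ` is the free product of two cyclic groups, generated by the
other two generators, so that an action is a choice of two permutations `a, b`, subject only to
`a ^ m = 1` and `b ^ n = 1`. Hyperbolicity allows `m, n` to be chosen finite, both at least `2` and
one of them, say `n`, at least `3`. For a countable group `A` such an action is a covering with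
group `A`: the cycles of `b` of length `n` are hubs, indexed by `A × ℕ`; the cycles of `a` of
length `m` are links, each meeting two hubs. Within a sheet `{g} × ℕ` the hubs form a chain, and
further links join the sheet of `g` to those of `g * e 0, g * e 1, …`, where `e` enumerates `A`;
this makes the action transitive. A hub needs three places for links, except the first one of each
chain, which needs only two. This recognises the first hubs, and on each of them a single point, by
means of `a` and `b` alone, so every point fixed by the stabiliser of the base point lies in its
`A`-orbit (`HubGraph.isRigidAction`).
-/

/-! ### Automorphisms of a transitive action -/

/-- The subgroup `H` of `Sym(Ω)` is transitive, and through `σ` the group `A` acts on `Ω` by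
permutations commuting with `H`, freely at `o`, and such that the orbit of `o` contains every point
fixed by the stabiliser of `o` in `H`. -/
structure IsRigidAction {A : Type*} {Ω : Type*} [Group A] (H : Subgroup (Equiv.Perm Ω))
    (σ : A →* Equiv.Perm Ω) (o : Ω) : Prop where
  transitive : ∀ ω, ∃ γ ∈ H, γ o = ω
  comm : ∀ γ ∈ H, ∀ g ω, σ g (γ ω) = γ (σ g ω)
  free : ∀ g, σ g o = o → g = 1
  rigid : ∀ ω, (∀ γ ∈ H, γ o = o → γ ω = ω) → ∃ g, σ g o = ω

namespace IsRigidAction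

variable {A : Type*} {Ω : Type*} [Group A] {H : Subgroup (Equiv.Perm Ω)}
  {σ : A →* Equiv.Perm Ω} {o : Ω}

theorem injective (h : IsRigidAction H σ o) {g g' : A} (e : σ g o = σ g' o) : g = g' := by
  have := h.free (g'⁻¹ * g) (by
    rw [map_mul, Equiv.Perm.mul_apply, e, ← Equiv.Perm.mul_apply, ← map_mul]; simp)
  exact (inv_mul_eq_one.mp this).symm

/-- The subgroup `M` is the stabiliser of `o`: its normaliser consists of the elements mapping `o`
into the `A`-orbit of `o`. -/
theorem exists_normalizer_quotient {G : Type*} [Group G] {ρ : G →* Equiv.Perm Ω}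
    (h : IsRigidAction ρ.range σ o) : ∃ M : Subgroup G, Nonempty (A ≃*
      Subgroup.normalizer (M : Set G) ⧸ M.subgroupOf (Subgroup.normalizer (M : Set G))) := by
  let M : Subgroup G := (MulAction.stabilizer (Equiv.Perm Ω) o).comap ρ
  have hM : ∀ γ, γ ∈ M ↔ ρ γ o = o := fun γ => Iff.rfl
  have hcomm : ∀ γ g ω, σ g (ρ γ ω) = ρ γ (σ g ω) := fun γ => h.comm _ ⟨γ, rfl⟩
  have hN : ∀ γ : Subgroup.normalizer (M : Set G), ∃ g, σ g o = ρ γ o := by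
    rintro ⟨γ, hγ⟩
    refine h.rigid _ ?_
    rintro _ ⟨δ, rfl⟩ hδ
    have := (Subgroup.mem_normalizer_iff''.mp hγ δ).mp hδ
    rw [hM] at this
    rwa [map_mul, map_mul, map_inv, Equiv.Perm.mul_apply, Equiv.Perm.mul_apply,
      Equiv.Perm.inv_eq_iff_eq] at this
  choose f hf using hN
  -- `γ ↦ f γ` reverses products, as the actions of `Γ` and `A` commute.
  let F : Subgroup.normalizer (M : Set G) →* A :=
    MonoidHom.mk' (fun γ => (f γ)⁻¹) (by
      intro γ δ
      rw [← mul_inv_rev, inv_inj]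
      apply h.injective
      rw [hf, map_mul, Equiv.Perm.mul_apply, hf, hcomm, hf]
      simp)
  have hF : Function.Surjective F := by
    intro g
    obtain ⟨_, ⟨γ, rfl⟩, hγ⟩ := h.transitive (σ g⁻¹ o)
    have hγ' : (ρ γ)⁻¹ o = σ g o := by
      rw [Equiv.Perm.inv_eq_iff_eq, ← hcomm, hγ, ← Equiv.Perm.mul_apply, ← map_mul]
      simp
    have hmem : γ ∈ Subgroup.normalizer (M : Set G) := by
      rw [Subgroup.mem_normalizer_iff]
      intro δ
      rw [hM, hM, map_mul, map_mul, map_inv, Equiv.Perm.mul_apply,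
        Equiv.Perm.mul_apply, hγ', ← Equiv.Perm.eq_inv_iff_eq (f := ρ γ), hγ', ← hcomm,
        (σ g).injective.eq_iff]
    refine ⟨⟨γ, hmem⟩, inv_eq_iff_eq_inv.mpr (h.injective ?_)⟩
    rw [hf, hγ]
  have hker : F.ker = M.subgroupOf (Subgroup.normalizer (M : Set G)) := by
    ext γ
    rw [MonoidHom.mem_ker, Subgroup.mem_subgroupOf, hM, ← hf]
    refine ⟨fun e => ?_, fun e => inv_eq_one.mpr (h.free _ e)⟩
    rw [inv_eq_one.mp e, map_one, Equiv.Perm.one_apply]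
  exact ⟨M, ⟨((QuotientGroup.quotientMulEquivOfEq hker.symm).trans
    (QuotientGroup.quotientKerEquivOfSurjective F hF)).symm⟩⟩

end IsRigidAction

/-! ### Monodromy and automorphisms of hypermaps -/

namespace OrientedHypermap

variable {p q r : ℕ∞}

theorem monodromy_of_zero (O : OrientedHypermap.{w} p q r) :
    O.monodromy (PresentedGroup.of 0) = O.x := PresentedGroup.toGroup.of _

theorem monodromy_of_one (O : OrientedHypermap.{w} p q r) :
    O.monodromy (PresentedGroup.of 1) = O.y := PresentedGroup.toGroup.of _

theorem monodromy_of_two (O : OrientedHypermap.{w} p q r) :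
    O.monodromy (PresentedGroup.of 2) = O.z := PresentedGroup.toGroup.of _

theorem range_monodromy (O : OrientedHypermap.{w} p q r) :
    O.monodromy.range = Subgroup.closure {O.x, O.y, O.z} := by
  rw [MonoidHom.range_eq_map, ← PresentedGroup.closure_range_of, MonoidHom.map_closure,
    ← Set.range_comp]
  congr 1
  ext γ
  simp [Fin.exists_fin_succ, monodromy_of_zero, monodromy_of_one, monodromy_of_two, eq_comm]

theorem Hom.map_monodromy {O₁ O₂ : OrientedHypermap.{w} p q r} (φ : Hom O₁ O₂)
    (γ : TriangleGroup p q r) (ω : O₁.Ω) :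
    φ.toFun (O₁.monodromy γ ω) = O₂.monodromy γ (φ.toFun ω) := by
  have hγ : γ ∈ Subgroup.closure (Set.range (PresentedGroup.of (rels := triangleRelators p q r))) :=
    PresentedGroup.closure_range_of _ ▸ Subgroup.mem_top γ
  induction hγ using Subgroup.closure_induction generalizing ω with
  | mem γ hγ =>
    obtain ⟨i, rfl⟩ := hγ
    fin_cases i
    · simpa [monodromy_of_zero] using φ.map_x ω
    · simpa [monodromy_of_one] using φ.map_y ω
    · simpa [monodromy_of_two] using φ.map_z ω
  | one => simp
  | mul γ δ _ _ hγ hδ => simp [hγ, hδ]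
  | inv γ _ hγ => rw [map_inv, map_inv, Equiv.Perm.eq_inv_iff_eq, ← hγ]; simp

theorem nonempty_mulEquiv_aut {A : Type*} [Group A] {O : OrientedHypermap.{w} p q r}
    {σ : A →* Equiv.Perm O.Ω} {o : O.Ω} (h : IsRigidAction O.monodromy.range σ o) :
    Nonempty (A ≃* Aut O) := by
  have hx : O.x ∈ O.monodromy.range := ⟨_, O.monodromy_of_zero⟩
  have hy : O.y ∈ O.monodromy.range := ⟨_, O.monodromy_of_one⟩
  have hz : O.z ∈ O.monodromy.range := ⟨_, O.monodromy_of_two⟩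
  let ψ : A → (O ⟶ O) := fun g => (⟨σ g, h.comm _ hx g, h.comm _ hy g, h.comm _ hz g⟩ : Hom O O)
  have hψ : ∀ g g' : A, ψ g ≫ ψ g' = ψ (g' * g) := fun g g' =>
    Hom.ext (by ext ω; change σ g' (σ g ω) = σ (g' * g) ω; simp)
  have hψ1 : ψ 1 = 𝟙 O := Hom.ext (by ext ω; change σ 1 ω = ω; simp)
  let Ψ : A →* Aut O := MonoidHom.mk'
    (fun g => ⟨ψ g, ψ g⁻¹, by rw [hψ, inv_mul_cancel, hψ1], by rw [hψ, mul_inv_cancel, hψ1]⟩)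
    (fun g g' => Iso.ext (hψ g' g).symm)
  refine ⟨MulEquiv.ofBijective Ψ ⟨fun g g' e => h.injective ?_, fun φ => ?_⟩⟩
  · exact congrFun (congrArg (fun φ : Aut O => Hom.toFun φ.hom) e) o
  · -- The image of `o` under an automorphism has the same stabiliser as `o`.
    obtain ⟨g, hg⟩ := h.rigid (Hom.toFun φ.hom o) (by
      rintro _ ⟨γ, rfl⟩ e
      rw [← Hom.map_monodromy, e])
    refine ⟨g, Iso.ext (Hom.ext (funext fun ω => ?_))⟩
    obtain ⟨_, ⟨γ, rfl⟩, rfl⟩ := h.transitive ω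
    change σ g _ = _
    rw [Hom.map_monodromy, ← hg, h.comm _ ⟨γ, rfl⟩]

end OrientedHypermap

/-! ### Two permutations with prescribed centraliser -/

/-- Rotation by one step of all cycles of a disjoint union of `S` cycles of length `n`. -/
def cycleRotation (S : Type*) (n : ℕ) : Equiv.Perm (S × ZMod n) :=
  Equiv.prodCongr (Equiv.refl S) (Equiv.addRight 1)

theorem cycleRotation_pow_apply {S : Type*} {n : ℕ} (k : ℕ) (s : S) (j : ZMod n) :
    (cycleRotation S n ^ k) (s, j) = (s, j + k) := by
  induction k with
  | zero => simp
  | succ k ih => rw [pow_succ', Equiv.Perm.mul_apply, ih]; simp [cycleRotation, add_assoc]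

theorem cycleRotation_pow (S : Type*) (n : ℕ) : cycleRotation S n ^ n = 1 := by
  ext1 ⟨s, j⟩
  simp [cycleRotation_pow_apply]

namespace HubGraph

variable {A : Type w} [Group A]

/-- The underlying set of the permutation representation: the `n`-cycles of one permutation, one
for each hub in `A × ℕ`, and the points of the links, `m`-cycles indexed by `A × ℕ × Bool`, other
than the two points `0` and `1` of each link, which lie on hubs. -/
abbrev Point (A : Type w) (m n : ℕ) : Type w :=
  ((A × ℕ) × ZMod n) ⊕ {t : (A × ℕ × Bool) × ZMod m // t.2 ≠ 0 ∧ t.2 ≠ 1}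

/-- The place of the point `0` of a link. -/
def tail (n : ℕ) : A × ℕ × Bool → (A × ℕ) × ZMod n
  | (g, k, false) => ((g, k), -2)
  | (g, k, true) => ((g, 2 * k), -1)

/-- The place of the point `1` of a link. Links `(g, k, false)` form, for fixed `g`, a chain through
the hubs `(g, 0), (g, 1), …`; links `(g, k, true)` lead from the chain of `g` to that of
`g * e k`. -/
def head (n : ℕ) (e : ℕ → A) : A × ℕ × Bool → (A × ℕ) × ZMod n
  | (g, k, false) => ((g, k + 1), -3)
  | (g, k, true) => ((g * e k, 2 * k + 1), -1)

/-- The inclusion of the links in the set of points. -/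
def linkPoint (m n : ℕ) (e : ℕ → A) (t : (A × ℕ × Bool) × ZMod m) : Point A m n :=
  if h₀ : t.2 = 0 then Sum.inl (tail n t.1) else
    if h₁ : t.2 = 1 then Sum.inl (head n e t.1) else Sum.inr ⟨t, h₀, h₁⟩

/-- The permutation rotating the hubs and fixing all other points. -/
def hubRotation (A : Type w) (m n : ℕ) : Equiv.Perm (Point A m n) :=
  Equiv.sumCongr (cycleRotation (A × ℕ) n) (Equiv.refl _)

/-- Left multiplication by `A` on the points. -/
def translation (A : Type w) [Group A] (m n : ℕ) : A →* Equiv.Perm (Point A m n) :=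
  MonoidHom.toHomPerm
    { toFun := fun g => Sum.map (fun s => ((g * s.1.1, s.1.2), s.2))
        (fun t => ⟨((g * t.1.1.1, t.1.1.2), t.1.2), t.2⟩)
      map_one' := by
        funext ω
        rcases ω with s | t <;> simp [Function.End.one_def]
      map_mul' := fun g g' => by
        funext ω
        rcases ω with s | t <;> simp [mul_assoc] <;> rfl }

variable {m n : ℕ} {e : ℕ → A}

theorem translation_inl (g : A) (s : (A × ℕ) × ZMod n) :
    translation A m n g (Sum.inl s) = Sum.inl ((g * s.1.1, s.1.2), s.2) := rfl

theorem translation_inr (g : A) (t : {t : (A × ℕ × Bool) × ZMod m // t.2 ≠ 0 ∧ t.2 ≠ 1}) :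
    translation A m n g (Sum.inr t) = Sum.inr ⟨((g * t.1.1.1, t.1.1.2), t.1.2), t.2⟩ := rfl

theorem translation_linkPoint (g : A) (t : (A × ℕ × Bool) × ZMod m) :
    translation A m n g (linkPoint m n e t) = linkPoint m n e ((g * t.1.1, t.1.2), t.2) := by
  obtain ⟨⟨g', k, c⟩, i⟩ := t
  unfold linkPoint
  split_ifs <;> cases c <;> simp [translation_inl, translation_inr, tail, head, mul_assoc]

theorem two_ne_zero_zmod (hn : 3 ≤ n) : (2 : ZMod n) ≠ 0 := fun h => by
  have := Nat.le_of_dvd (by norm_num) ((ZMod.natCast_eq_zero_iff 2 n).mp (by exact_mod_cast h))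
  omega

theorem one_ne_zero_zmod (hm : 2 ≤ m) : (1 : ZMod m) ≠ 0 := fun h => by
  have := Nat.le_of_dvd (by norm_num) ((ZMod.natCast_eq_zero_iff 1 m).mp (by exact_mod_cast h))
  omega

theorem linkPoint_zero (t : A × ℕ × Bool) : linkPoint m n e (t, 0) = Sum.inl (tail n t) := by
  simp [linkPoint]

theorem linkPoint_one (hm : 2 ≤ m) (t : A × ℕ × Bool) :
    linkPoint m n e (t, 1) = Sum.inl (head n e t) := by
  simp [linkPoint, one_ne_zero_zmod hm]

theorem linkPoint_injective (hn : 3 ≤ n) : Function.Injective (linkPoint m n e) := by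
  have h1 : (1 : ZMod n) ≠ 0 := one_ne_zero_zmod (by omega)
  have h2 := two_ne_zero_zmod hn
  have h12 : (-1 : ZMod n) ≠ -2 := fun h => h1 (by linear_combination h)
  have h23 : (-2 : ZMod n) ≠ -3 := fun h => h1 (by linear_combination h)
  have h13 : (-1 : ZMod n) ≠ -3 := fun h => h2 (by linear_combination h)
  rintro ⟨⟨g, k, c⟩, i⟩ ⟨⟨g', k', c'⟩, i'⟩ h
  unfold linkPoint at h
  split_ifs at h with ha hb hc hd <;> cases c <;> cases c' <;>
    simp_all [tail, head, h12.symm, h23.symm, h13.symm]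
  · omega
  · omega
  · rw [h.2] at h
    exact mul_right_cancel h.1

/-- The permutation rotating the links and fixing the points on no link. -/
noncomputable def linkRotation (m : ℕ) (hn : 3 ≤ n) (e : ℕ → A) : Equiv.Perm (Point A m n) :=
  (cycleRotation (A × ℕ × Bool) m).viaEmbedding ⟨linkPoint m n e, linkPoint_injective hn⟩

theorem linkRotation_linkPoint (hn : 3 ≤ n) (t : A × ℕ × Bool) (i : ZMod m) :
    linkRotation m hn e (linkPoint m n e (t, i)) = linkPoint m n e (t, i + 1) :=
  Equiv.Perm.viaEmbedding_apply _ ⟨linkPoint m n e, linkPoint_injective hn⟩ (t, i)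

theorem linkRotation_pow (m : ℕ) (hn : 3 ≤ n) (e : ℕ → A) : linkRotation m hn e ^ m = 1 := by
  have := map_pow (Equiv.Perm.viaEmbeddingHom ⟨linkPoint m n e, linkPoint_injective hn⟩)
    (cycleRotation (A × ℕ × Bool) m) m
  rw [cycleRotation_pow, map_one] at this
  exact this.symm

theorem linkRotation_eq_self_iff (hm : 2 ≤ m) (hn : 3 ≤ n) (ω : Point A m n) :
    linkRotation m hn e ω = ω ↔ ω ∉ Set.range (linkPoint m n e) := by
  refine ⟨?_, fun h => Equiv.Perm.viaEmbedding_apply_of_notMem _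
    ⟨linkPoint m n e, linkPoint_injective hn⟩ _ h⟩
  rintro h ⟨⟨t, i⟩, rfl⟩
  rw [linkRotation_linkPoint, (linkPoint_injective hn).eq_iff] at h
  exact one_ne_zero_zmod hm (by simpa using h)

theorem hubRotation_pow_inl {A : Type w} (k : ℕ) (s : A × ℕ) (j : ZMod n) :
    (hubRotation A m n ^ k) (Sum.inl (s, j)) = Sum.inl (s, j + k) := by
  induction k with
  | zero => simp
  | succ k ih =>
    rw [pow_succ', Equiv.Perm.mul_apply, ih]
    simp [hubRotation, cycleRotation, add_assoc]

theorem hubRotation_pow (A : Type w) (m n : ℕ) : hubRotation A m n ^ n = 1 := by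
  have := map_pow (Equiv.Perm.sumCongrHom ((A × ℕ) × ZMod n)
    {t : (A × ℕ × Bool) × ZMod m // t.2 ≠ 0 ∧ t.2 ≠ 1}) (cycleRotation (A × ℕ) n, 1) n
  rw [Prod.pow_mk, cycleRotation_pow, one_pow] at this
  exact this.symm.trans (map_one _)

/-- The representation generated by the two rotations is rigid. Every point of a link is moved by
the link rotation, as are the positions `-1`, `-2`, `-3` of each hub, except for position `-3` of
the hubs `(g, 0)`; nothing else is moved. Hence the points `((g, 0), 0)` are characterised by the
property that the link rotation fixes their images under the powers of the hub rotation, except for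
the two powers `-1` and `-2`. -/
theorem isRigidAction (hm : 2 ≤ m) (hn : 3 ≤ n) (he : Function.Surjective e) :
    IsRigidAction (Subgroup.closure {linkRotation m hn e, hubRotation A m n})
      (translation A m n) (Sum.inl ((1, 0), 0)) := by
  have : NeZero n := ⟨by omega⟩
  have : NeZero m := ⟨by omega⟩
  set a := linkRotation m hn e with ha
  set b := hubRotation A m n with hb
  have h1 : (1 : ZMod n) ≠ 0 := one_ne_zero_zmod (by omega)
  have h2 := two_ne_zero_zmod hn
  have haH : a ∈ Subgroup.closure {a, b} := Subgroup.subset_closure (by simp)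
  have hbH : b ∈ Subgroup.closure {a, b} := Subgroup.subset_closure (by simp)
  have hbpow (s : A × ℕ) (j i : ZMod n) : (b ^ i.val) (Sum.inl (s, j)) = Sum.inl (s, j + i) := by
    rw [hb, hubRotation_pow_inl, ZMod.natCast_zmod_val]
  refine ⟨?_, ?_, ?_, ?_⟩
  · let R : Point A m n → Point A m n → Prop := fun ω ω' => ∃ γ ∈ Subgroup.closure {a, b}, γ ω = ω'
    have hrefl : ∀ ω, R ω ω := fun ω => ⟨1, one_mem _, rfl⟩
    have hsymm : ∀ {ω ω'}, R ω ω' → R ω' ω := by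
      rintro ω _ ⟨γ, hγ, rfl⟩
      exact ⟨γ⁻¹, inv_mem hγ, by simp⟩
    have htrans : ∀ {ω ω' ω''}, R ω ω' → R ω' ω'' → R ω ω'' := by
      rintro ω _ _ ⟨γ, hγ, rfl⟩ ⟨δ, hδ, rfl⟩
      exact ⟨δ * γ, mul_mem hδ hγ, rfl⟩
    have hhub (s : A × ℕ) (j i : ZMod n) : R (Sum.inl (s, j)) (Sum.inl (s, i)) :=
      ⟨b ^ (i - j).val, pow_mem hbH _, by rw [hbpow]; simp⟩
    have hlink (t : A × ℕ × Bool) (i : ZMod m) : R (Sum.inl (tail n t)) (linkPoint m n e (t, i)) := by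
      rw [← linkPoint_zero, ← ZMod.natCast_zmod_val i]
      induction i.val with
      | zero => simpa using hrefl _
      | succ k ih =>
        exact htrans ih ⟨a, haH, by rw [ha, linkRotation_linkPoint]; push_cast; rfl⟩
    have hends (t : A × ℕ × Bool) : R (Sum.inl (tail n t)) (Sum.inl (head n e t)) :=
      linkPoint_one (e := e) hm t ▸ hlink t 1
    have hchain (g : A) (k : ℕ) (j : ZMod n) : R (Sum.inl ((g, 0), 0)) (Sum.inl ((g, k), j)) := by
      induction k generalizing j with
      | zero => exact hhub _ _ _
      | succ k ih => exact htrans (htrans (ih _) (hends (g, k, false))) (hhub _ _ _)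
    have hsheet (g : A) : R (Sum.inl ((1, 0), 0)) (Sum.inl ((g, 0), 0)) := by
      obtain ⟨k, rfl⟩ := he g
      have := hends (1, k, true)
      simp only [tail, head, one_mul] at this
      exact htrans (htrans (hchain _ _ _) this) (hsymm (hchain _ _ _))
    rintro (⟨⟨g, k⟩, j⟩ | ⟨⟨⟨g, k, c⟩, i⟩, h₀, h₁⟩)
    · exact htrans (hsheet g) (hchain _ _ _)
    · have h := hlink (g, k, c) i
      rw [linkPoint, dif_neg h₀, dif_neg h₁] at h
      refine htrans (hsheet g) (htrans ?_ h)
      cases c <;> exact hchain _ _ _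
  · intro γ hγ g
    induction hγ using Subgroup.closure_induction with
    | mem γ hγ =>
      rintro ω
      rcases hγ with rfl | rfl
      · by_cases hω : ω ∈ Set.range (linkPoint m n e)
        · obtain ⟨⟨t, i⟩, rfl⟩ := hω
          rw [ha, linkRotation_linkPoint, translation_linkPoint, translation_linkPoint,
            linkRotation_linkPoint]
        · have hω' : translation A m n g ω ∉ Set.range (linkPoint m n e) := by
            rintro ⟨t, ht⟩
            refine hω ⟨((g⁻¹ * t.1.1, t.1.2), t.2), ?_⟩
            rw [← translation_linkPoint, ht, ← Equiv.Perm.mul_apply, ← map_mul]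
            simp
          rw [ha, (linkRotation_eq_self_iff hm hn _).mpr hω,
            (linkRotation_eq_self_iff hm hn _).mpr hω']
      · rcases ω with s | t <;> rfl
    | one => simp
    | mul γ δ _ _ hγ hδ => simp [hγ, hδ]
    | inv γ _ hγ => intro ω; rw [Equiv.Perm.eq_inv_iff_eq, ← hγ]; simp
  · intro g hg
    simpa [translation_inl] using hg
  · intro ω hω
    have htail (t : A × ℕ × Bool) : a (Sum.inl (tail n t)) ≠ Sum.inl (tail n t) := fun h =>
      (linkRotation_eq_self_iff hm hn _).mp h ⟨(t, 0), linkPoint_zero t⟩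
    have hhead (t : A × ℕ × Bool) : a (Sum.inl (head n e t)) ≠ Sum.inl (head n e t) := fun h =>
      (linkRotation_eq_self_iff hm hn _).mp h ⟨(t, 1), linkPoint_one hm t⟩
    have hfix (i : ZMod n) (hi₁ : i ≠ -1) (hi₂ : i ≠ -2) : a ((b ^ i.val) ω) = (b ^ i.val) ω := by
      have := hω ((b ^ i.val)⁻¹ * a * b ^ i.val)
        (mul_mem (mul_mem (inv_mem (pow_mem hbH _)) haH) (pow_mem hbH _)) (by
          rw [Equiv.Perm.mul_apply, Equiv.Perm.mul_apply, Equiv.Perm.inv_eq_iff_eq, hbpow, zero_add]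
          refine (linkRotation_eq_self_iff hm hn _).mpr ?_
          rintro ⟨⟨⟨g, k, c⟩, i'⟩, ht⟩
          unfold linkPoint at ht
          split_ifs at ht <;> cases c <;> simp_all [tail, head])
      rwa [Equiv.Perm.mul_apply, Equiv.Perm.mul_apply, Equiv.Perm.inv_eq_iff_eq] at this
    rcases ω with ⟨⟨g, k⟩, j⟩ | ⟨⟨t, i⟩, h₀, h₁⟩
    · simp only [hbpow] at hfix
      have hm1 : a (Sum.inl ((g, k), -1)) ≠ Sum.inl ((g, k), -1) := by
        obtain ⟨l, rfl | rfl⟩ := Nat.even_or_odd' k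
        · exact htail (g, l, true)
        · simpa [head] using hhead (g * (e l)⁻¹, l, true)
      have hj : j = 0 := by
        by_contra hj
        have hj1 : j = 1 := by
          by_contra hj1
          refine hm1 ?_
          have := hfix (-1 - j) (fun h => hj (by linear_combination -h))
            (fun h => hj1 (by linear_combination -h))
          rwa [add_sub_cancel] at this
        have := hfix (-2 - j) (fun h => h2 (by linear_combination -h - hj1))
            (fun h => hj (by linear_combination -h))
        rw [add_sub_cancel] at this
        exact htail (g, k, false) this
      subst hj
      obtain _ | k := k
      · exact ⟨g, by simp [translation_inl]⟩
      · have := hfix (-3) (fun h => h2 (by linear_combination -h))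
          (fun h => h1 (by linear_combination -h))
        rw [zero_add] at this
        exact absurd this (hhead (g, k, false))
    · have := hfix 0 (fun h => h1 (by linear_combination h)) (fun h => h2 (by linear_combination h))
      rw [ZMod.val_zero, pow_zero, Equiv.Perm.one_apply] at this
      refine absurd ⟨(t, i), ?_⟩ ((linkRotation_eq_self_iff hm hn _).mp this)
      rw [linkPoint, dif_neg h₀, dif_neg h₁]

end HubGraph

/-! ### Triangle groups with an infinite period -/

theorem exists_isRigidAction (A : Type w) [Group A] [Countable A] {m n : ℕ} (hm : 2 ≤ m)
    (hn : 2 ≤ n) (hmn : 3 ≤ m ∨ 3 ≤ n) :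
    ∃ (Ω : Type w) (a b : Equiv.Perm Ω) (σ : A →* Equiv.Perm Ω) (o : Ω),
      a ^ m = 1 ∧ b ^ n = 1 ∧ IsRigidAction (Subgroup.closure {a, b}) σ o := by
  obtain ⟨e, he⟩ := exists_surjective_nat A
  rcases hmn with h | h
  · refine ⟨_, HubGraph.hubRotation A n m, HubGraph.linkRotation n h e,
      HubGraph.translation A n m, Sum.inl ((1, 0), 0),
      HubGraph.hubRotation_pow _ _ _, HubGraph.linkRotation_pow _ _ _, ?_⟩
    rw [Set.pair_comm]
    exact HubGraph.isRigidAction hn h he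
  · exact ⟨_, _, _, _, _, HubGraph.linkRotation_pow m h e, HubGraph.hubRotation_pow _ _ _,
      HubGraph.isRigidAction hm h he⟩

/-- Two exponents with `1/p + 1/q < 1` may be replaced by finite ones, both at least `2` and one at
least `3`. -/
theorem exists_finite_exponents {p q : ℕ∞} (h : (p : ℝ≥0∞)⁻¹ + (q : ℝ≥0∞)⁻¹ < 1) :
    ∃ m n : ℕ, (∀ k : ℕ, p = k → k = m) ∧ (∀ k : ℕ, q = k → k = n) ∧ 2 ≤ m ∧ 2 ≤ n ∧
      (3 ≤ m ∨ 3 ≤ n) := by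
  have key (p : ℕ∞) (hp : (p : ℝ≥0∞)⁻¹ < 1) : ∃ m : ℕ, (∀ k : ℕ, p = k → k = m) ∧ 2 ≤ m ∧
      (m = 2 → p = 2) := by
    induction p using ENat.recTopCoe with
    | top => exact ⟨3, by simp, by norm_num, by norm_num⟩
    | coe m =>
      refine ⟨m, fun k hk => by exact_mod_cast hk.symm, ?_, by rintro rfl; rfl⟩
      rw [ENNReal.inv_lt_one] at hp
      exact_mod_cast hp
  obtain ⟨m, hm, hm2, hm'⟩ := key p (lt_of_le_of_lt le_self_add h)
  obtain ⟨n, hn, hn2, hn'⟩ := key q (lt_of_le_of_lt le_add_self h)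
  refine ⟨m, n, hm, hn, hm2, hn2, ?_⟩
  by_contra! hlt
  rw [hm' (by omega), hn' (by omega)] at h
  simp [ENNReal.inv_two_add_inv_two] at h

theorem closure_inv_mul {G : Type*} [Group G] (a b : G) :
    Subgroup.closure {(a * b)⁻¹, a, b} = Subgroup.closure {a, b} := by
  refine le_antisymm ((Subgroup.closure_le _).mpr ?_)
    (Subgroup.closure_mono (Set.subset_insert _ _))
  rintro _ (rfl | h)
  · exact inv_mem (mul_mem (Subgroup.subset_closure (by simp)) (Subgroup.subset_closure (by simp)))
  · exact Subgroup.subset_closure h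

/-- In a hypermap whose type has an infinite entry, two of the three permutations can be prescribed
freely, and they determine the third, of exponent `∞`. -/
theorem exists_hypermap_isRigidAction {p q r : ℕ∞} (hyp : IsHyperbolicTriple p q r)
    (hinf : p = ⊤ ∨ q = ⊤ ∨ r = ⊤) (A : Type w) [Group A] [Countable A] :
    ∃ (O : OrientedHypermap.{w} p q r) (σ : A →* Equiv.Perm O.Ω) (o : O.Ω),
      IsRigidAction O.monodromy.range σ o := by
  unfold IsHyperbolicTriple at hyp
  rcases hinf with rfl | rfl | rfl
  · obtain ⟨m, n, hm, hn, hm2, hn2, hmn⟩ := exists_finite_exponents (p := q) (q := r)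
      (by simpa using hyp)
    obtain ⟨Ω, a, b, σ, o, ha, hb, h⟩ := exists_isRigidAction A hm2 hn2 hmn
    refine ⟨⟨Ω, (a * b)⁻¹, a, b, by simp, fun k hk => hm k hk ▸ ha, fun k hk => hn k hk ▸ hb,
      by group⟩, σ, o, ?_⟩
    rw [OrientedHypermap.range_monodromy]
    exact (closure_inv_mul a b).symm ▸ h
  · obtain ⟨m, n, hm, hn, hm2, hn2, hmn⟩ := exists_finite_exponents (p := r) (q := p)
      (by simpa [add_comm] using hyp)
    obtain ⟨Ω, a, b, σ, o, ha, hb, h⟩ := exists_isRigidAction A hm2 hn2 hmn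
    refine ⟨⟨Ω, b, (a * b)⁻¹, a, fun k hk => hn k hk ▸ hb, by simp, fun k hk => hm k hk ▸ ha,
      by group⟩, σ, o, ?_⟩
    rw [OrientedHypermap.range_monodromy]
    rw [show ({b, (a * b)⁻¹, a} : Set (Equiv.Perm Ω)) = {(a * b)⁻¹, a, b} by ext; simp; tauto]
    exact (closure_inv_mul a b).symm ▸ h
  · obtain ⟨m, n, hm, hn, hm2, hn2, hmn⟩ := exists_finite_exponents (p := p) (q := q)
      (by simpa using hyp)
    obtain ⟨Ω, a, b, σ, o, ha, hb, h⟩ := exists_isRigidAction A hm2 hn2 hmn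
    refine ⟨⟨Ω, a, b, (a * b)⁻¹, fun k hk => hm k hk ▸ ha, fun k hk => hn k hk ▸ hb, by simp,
      by group⟩, σ, o, ?_⟩
    rw [OrientedHypermap.range_monodromy]
    rw [show ({a, b, (a * b)⁻¹} : Set (Equiv.Perm Ω)) = {(a * b)⁻¹, a, b} by ext; simp; tauto]
    exact (closure_inv_mul a b).symm ▸ h

theorem theorem5p1 (p q r : ℕ∞) (hyp : IsHyperbolicTriple p q r)
    (hinf : p = ⊤ ∨ q = ⊤ ∨ r = ⊤) :
    GroupHasCARP.{0, v} (TriangleGroup p q r) ∧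
      CategoryHasCARP.{w + 1, v, w} (OrientedHypermap.{w} p q r)
        OrientedHypermap.IsConnected := by
  constructor
  · intro A _ _
    have s : A ≃* Shrink.{0} A := Shrink.mulEquiv.symm
    have : Countable (Shrink.{0} A) := s.symm.injective.countable
    obtain ⟨O, σ, o, h⟩ := exists_hypermap_isRigidAction hyp hinf (Shrink.{0} A)
    obtain ⟨M, ⟨f⟩⟩ := h.exists_normalizer_quotient
    exact ⟨M, ⟨s.trans f⟩⟩
  · intro A _ _
    have s : A ≃* Shrink.{w} A := Shrink.mulEquiv.symm
    have : Countable (Shrink.{w} A) := s.symm.injective.countable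
    obtain ⟨O, σ, o, h⟩ := exists_hypermap_isRigidAction hyp hinf (Shrink.{w} A)
    obtain ⟨f⟩ := OrientedHypermap.nonempty_mulEquiv_aut h
    refine ⟨O, ⟨⟨o⟩, fun ω ω' => ?_⟩, ⟨s.trans f⟩⟩
    obtain ⟨_, ⟨γ, rfl⟩, rfl⟩ := h.transitive ω
    obtain ⟨_, ⟨δ, rfl⟩, rfl⟩ := h.transitive ω'
    exact ⟨δ * γ⁻¹, by simp⟩
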